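/- Let $K=\mathbb{R}$ or $K=\mathbb{C}$ and let $d\ge 1$. Put $J=\begin{bmatrix}0&I_d\\-I_d&0\end{bmatrix}$, call $H\in K^{2d\times 2d}$ symplectic if $H^{T}JH=J$, and call a symplectic matrix $H$ singular if $\det(H-I)=0$. A unit triangular symplectic matrix is a matrix of the form $\begin{bmatrix}I&S\\0&I\end{bmatrix}$ or $\begin{bmatrix}I&0\\S&I\end{bmatrix}$ with $S\in K^{d\times d}$ symmetric ($S^T=S$). Then the set of $2d\times 2d$ singular symplectic matrices over $K$ is \[ \left\{Q\begin{bmatrix}I&0\\ \begin{bmatrix}0&0\\0&S_{6}\end{bmatrix}&I\end{bmatrix}\begin{bmatrix}I&S_{5}\\0&I\end{bmatrix}\begin{bmatrix}I&0\\ \begin{bmatrix}0&0\\0&S_{4}\end{bmatrix}&I\end{bmatrix}\begin{bmatrix}I&S_{3}\\0&I\end{bmatrix}\begin{bmatrix}I&0\\ \begin{bmatrix}0&0\\0&S_{2}\end{bmatrix}&I\end{bmatrix}\begin{bmatrix}I&S_{1}\\0&I\end{bmatrix}Q^{-1}\right\}, \] where $S_1,S_3,S_5$ range over all symmetric matrices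 in $K^{d\times d}$, $S_2,S_4,S_6$ range over all symmetric matrices in $K^{(d-1)\times(d-1)}$ (so that each $\begin{bmatrix}0&0\\0&S_{2i}\end{bmatrix}$ is the $d\times d$ matrix with zero first row and column and lower right block $S_{2i}$; it is the zero matrix if $d=1$), and $Q$ ranges over all symplectic matrices in $K^{2d\times 2d}$. Moreover, every symplectic $Q\in K^{2d\times 2d}$ is a product of $5$ unit triangular symplectic matrices. -/

import Mathlib

open Matrix

namespace UnitTriangularSymplectic

/-- The block matrix `[I, S; 0, I]`. -/
def upper {d : ℕ} {K : Type*} [CommRing K] (S : Matrix (Fin d) (Fin d) K) :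
    Matrix (Fin d ⊕ Fin d) (Fin d ⊕ Fin d) K :=
  Matrix.fromBlocks 1 S 0 1

/-- The block matrix `[I, 0; S, I]`. -/
def lower {d : ℕ} {K : Type*} [CommRing K] (S : Matrix (Fin d) (Fin d) K) :
    Matrix (Fin d ⊕ Fin d) (Fin d ⊕ Fin d) K :=
  Matrix.fromBlocks 1 0 S 1

/-- The `d × d` matrix `diag(0, S)`, whose first row and first column vanish and whose lower
right `(d - 1) × (d - 1)` block is `S`. -/
def padZero {d : ℕ} {K : Type*} [CommRing K] (S : Matrix (Fin (d - 1)) (Fin (d - 1)) K) :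
    Matrix (Fin d) (Fin d) K :=
  Matrix.of fun i j =>
    if h : 0 < i.val ∧ 0 < j.val then
      S ⟨i.val - 1, by have := i.isLt; omega⟩ ⟨j.val - 1, by have := j.isLt; omega⟩
    else 0

/-- The set of unit triangular symplectic matrices of size `2d × 2d`. -/
def unitTriangular (d : ℕ) (K : Type*) [CommRing K] :
    Set (Matrix (Fin d ⊕ Fin d) (Fin d ⊕ Fin d) K) :=
  {H | ∃ S : Matrix (Fin d) (Fin d) K, S.IsSymm ∧ (H = upper S ∨ H = lower S)}

/-- The set of all products of `n` unit triangular symplectic matrices. -/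
def unitTriangularProducts (d : ℕ) (K : Type*) [CommRing K] (n : ℕ) :
    Set (Matrix (Fin d ⊕ Fin d) (Fin d ⊕ Fin d) K) :=
  {H | ∃ l : List (Matrix (Fin d ⊕ Fin d) (Fin d ⊕ Fin d) K),
    l.length = n ∧ (∀ A ∈ l, A ∈ unitTriangular d K) ∧ H = l.prod}

/-- The set of singular symplectic matrices: the symplectic `H` with `det (H - I) = 0`. -/
def singularSymplectic (d : ℕ) (K : Type*) [CommRing K] :
    Set (Matrix (Fin d ⊕ Fin d) (Fin d ⊕ Fin d) K) :=
  {H | H ∈ Matrix.symplecticGroup (Fin d) K ∧ (H - 1).det = 0}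

end UnitTriangularSymplectic

/-! Write H = [A B; C D]. A symmetric X makes G = A + XC invertible, and then C G⁻¹ is symmetric.
Over any field there is an invertible symmetric Z with ZG symmetric. Put P₂ = ZG, S₃ = Z⁻¹ - P₂⁻¹,
P₄ = C G⁻¹ - Z: then I + S₃P₂ = G and P₄G + P₂ = C, so upper(-X) lower(P₄) upper(S₃) lower(P₂) has
the same left half as H. Symplectic matrices with equal left halves differ by an upper factor on the
right, which gives five factors.

Singular means that 1 is an eigenvalue. Symplectic matrices act transitively on nonzero vectors, so
up to conjugation H fixes the first basis vector e. The construction is then run so that every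
factor fixes e, which for lower factors means padded blocks. Five factors already suffice, so S₆ =
0. Conversely, each of the six factors fixes e. -/

namespace UnitTriangularSymplectic

/-! ### Invariant symmetric forms and symmetrization of matrices -/

open Polynomial in
/-- A `K[X]`-module carries a nondegenerate symmetric `K`-bilinear form for which multiplication
by polynomials is self-adjoint. -/
def HasInvariantForm (K M : Type*) [Field K] [AddCommGroup M] [Module K[X] M] : Prop :=
  ∃ b : M → M → K, (∀ x y z, b (x + y) z = b x z + b y z) ∧ (∀ x y, b x y = b y x) ∧
    (∀ (p : K[X]) x y, b (p • x) y = b x (p • y)) ∧ (∀ (c : K) x y, b (C c • x) y = c * b x y) ∧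
    ∀ x, (∀ y, b x y = 0) → x = 0

open Polynomial in
theorem HasInvariantForm.of_linearEquiv {K M N : Type*} [Field K] [AddCommGroup M] [Module K[X] M]
    [AddCommGroup N] [Module K[X] N] (e : M ≃ₗ[K[X]] N) (h : HasInvariantForm K N) :
    HasInvariantForm K M := by
  obtain ⟨b, h1, h2, h3, h4, h5⟩ := h
  refine ⟨fun x y => b (e x) (e y), by simp [h1], fun x y => h2 _ _, by simp [h3], by simp [h4],
    fun x hx => ?_⟩
  have := h5 (e x) fun y => by simpa using hx (e.symm y)
  simpa using this

open Polynomial DirectSum in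
theorem HasInvariantForm.directSum {K ι : Type*} [Field K] [Fintype ι] {M : ι → Type*}
    [∀ i, AddCommGroup (M i)] [∀ i, Module K[X] (M i)] (h : ∀ i, HasInvariantForm K (M i)) :
    HasInvariantForm K (⨁ i, M i) := by
  classical
  choose b h1 h2 h3 h4 h5 using h
  have b0 : ∀ i x, b i x 0 = 0 := fun i x => by
    rw [h2]; simpa using h1 i 0 0 x
  refine ⟨fun x y => ∑ i, b i (x i) (y i), ?_, ?_, ?_, ?_, ?_⟩
  · intro x y z
    simp [h1, Finset.sum_add_distrib]
  · intro x y
    exact Finset.sum_congr rfl fun i _ => h2 i _ _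
  · intro p x y
    exact Finset.sum_congr rfl fun i _ => by simp [DirectSum.smul_apply, h3]
  · intro c x y
    rw [Finset.mul_sum]
    exact Finset.sum_congr rfl fun i _ => by simp only [DirectSum.smul_apply, h4]
  · intro x hx
    ext i
    refine h5 i _ fun y => ?_
    have := hx (DirectSum.of M i y)
    dsimp only at this
    rw [Finset.sum_eq_single i] at this
    · simpa using this
    · intro j _ hj
      rw [DirectSum.of_eq_of_ne _ _ _ hj, b0]
    · simp

-- The form sends (f, g) to the coefficient of X^(deg q - 1) in fg mod q.
open Polynomial in
theorem hasInvariantForm_quotient_span_monic {K : Type*} [Field K] {q : K[X]} (hq : q.Monic) :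
    HasInvariantForm K (K[X] ⧸ Ideal.span {q}) := by
  have hmod : ∀ f g : K[X], Ideal.Quotient.mk (Ideal.span {q}) f = Ideal.Quotient.mk _ g →
      f %ₘ q = g %ₘ q := by
    intro f g h
    rw [Ideal.Quotient.eq, Ideal.mem_span_singleton] at h
    rw [← sub_eq_zero, ← sub_modByMonic, modByMonic_eq_zero_iff_dvd hq]
    exact h
  -- For q = 1 the subtraction truncates harmlessly: the quotient is zero.
  let b : (K[X] ⧸ Ideal.span {q}) → (K[X] ⧸ Ideal.span {q}) → K := fun x y =>
    ((x * y).out %ₘ q).coeff (q.natDegree - 1)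
  have hb : ∀ f g : K[X], b (Ideal.Quotient.mk _ f) (Ideal.Quotient.mk _ g) =
      ((f * g) %ₘ q).coeff (q.natDegree - 1) := by
    intro f g
    change ((Quotient.out _) %ₘ q).coeff _ = _
    rw [hmod _ (f * g)]
    rw [map_mul]
    exact Quotient.out_eq' _
  have hs : ∀ p f : K[X], p • Ideal.Quotient.mk (Ideal.span {q}) f =
      Ideal.Quotient.mk _ (p * f) := fun p f => rfl
  refine ⟨b, ?_, ?_, ?_, ?_, ?_⟩
  · intro x y z
    obtain ⟨x, rfl⟩ := Ideal.Quotient.mk_surjective x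
    obtain ⟨y, rfl⟩ := Ideal.Quotient.mk_surjective y
    obtain ⟨z, rfl⟩ := Ideal.Quotient.mk_surjective z
    rw [← map_add, hb, hb, hb, add_mul, add_modByMonic, coeff_add]
  · intro x y
    simp only [b, mul_comm x y]
  · intro p x y
    obtain ⟨x, rfl⟩ := Ideal.Quotient.mk_surjective x
    obtain ⟨y, rfl⟩ := Ideal.Quotient.mk_surjective y
    rw [hs, hs, hb, hb, mul_assoc, mul_left_comm]
  · intro c x y
    obtain ⟨x, rfl⟩ := Ideal.Quotient.mk_surjective x
    obtain ⟨y, rfl⟩ := Ideal.Quotient.mk_surjective y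
    rw [hs, hb, hb, mul_assoc, ← smul_eq_C_mul, smul_modByMonic, coeff_smul, smul_eq_mul]
  · intro x hx
    obtain ⟨f, rfl⟩ := Ideal.Quotient.mk_surjective x
    have hr : Ideal.Quotient.mk (Ideal.span {q}) f = Ideal.Quotient.mk _ (f %ₘ q) := by
      rw [Ideal.Quotient.eq, Ideal.mem_span_singleton, ← dvd_neg, neg_sub]
      exact dvd_modByMonic_sub f q
    rw [hr] at hx ⊢
    have hdeg : (f %ₘ q).degree < q.degree := degree_modByMonic_lt f hq
    generalize f %ₘ q = r at *
    by_contra hne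
    have hr0 : r ≠ 0 := by
      rintro rfl
      exact hne (map_zero _)
    have hlt : r.natDegree < q.natDegree := natDegree_lt_natDegree hr0 hdeg
    -- Nondegeneracy: this power of X moves the leading coefficient of r to the position read by the
    -- form, without any reduction mod q.
    have h := hx (Ideal.Quotient.mk _ (X ^ (q.natDegree - 1 - r.natDegree)))
    have hd : (r * X ^ (q.natDegree - 1 - r.natDegree)).natDegree = q.natDegree - 1 := by
      rw [natDegree_mul_X_pow _ hr0]
      omega
    rw [hb, (modByMonic_eq_self_iff hq).2] at h
    · generalize q.natDegree - 1 - r.natDegree = k at h hd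
      rw [← hd, coeff_natDegree, leadingCoeff_mul_X_pow, leadingCoeff_eq_zero] at h
      exact hr0 h
    · apply degree_lt_degree
      omega

open Polynomial in
theorem hasInvariantForm_quotient_span {K : Type*} [Field K] {q : K[X]} (hq : q ≠ 0) :
    HasInvariantForm K (K[X] ⧸ Ideal.span {q}) := by
  classical
  have h : Ideal.span {q} = Ideal.span {normalize q} :=
    Ideal.span_singleton_eq_span_singleton.2 (associated_normalize q)
  rw [h]
  exact hasInvariantForm_quotient_span_monic (monic_normalize hq)

open Polynomial in
theorem hasInvariantForm_of_isTorsion {K M : Type*} [Field K] [AddCommGroup M] [Module K[X] M]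
    [Module.Finite K[X] M] (hM : Module.IsTorsion K[X] M) : HasInvariantForm K M := by
  obtain ⟨ι, _, p, hp, e, ⟨f⟩⟩ := Module.equiv_directSum_of_isTorsion hM
  exact .of_linearEquiv f (.directSum fun i =>
    hasInvariantForm_quotient_span (pow_ne_zero _ (hp i).ne_zero))

open Polynomial in
/-- Every square matrix over a field is symmetrized by some invertible symmetric matrix. -/
theorem exists_isSymm_mul_isSymm {K n : Type*} [Field K] [Fintype n] [DecidableEq n]
    (A : Matrix n n K) : ∃ Z : Matrix n n K, Z.IsSymm ∧ IsUnit Z.det ∧ (Z * A).IsSymm := by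
  let φ : Module.End K (n → K) := A.mulVecLin
  -- Let X act on Kⁿ as A; Z will be the Gram matrix of an invariant form, and ZA is symmetric
  -- because X is self-adjoint.
  have htor : Module.IsTorsion K[X] (Module.AEval' φ) := by
    intro x
    refine ⟨⟨minpoly K φ, mem_nonZeroDivisors_of_ne_zero
      (minpoly.ne_zero (Algebra.IsIntegral.isIntegral φ))⟩, ?_⟩
    obtain ⟨v, rfl⟩ := (Module.AEval'.of φ).surjective x
    change minpoly K φ • (Module.AEval.of K (n → K) φ) v = 0
    rw [← Module.AEval.of_aeval_smul, minpoly.aeval, zero_smul, map_zero]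
  obtain ⟨b, h1, h2, h3, h4, h5⟩ := hasInvariantForm_of_isTorsion htor
  have h4' : ∀ (c : K) x y, b (c • x) y = c * b x y := fun c x y => by
    rw [← h4, Module.AEval.C_smul]
  let o := Module.AEval'.of φ
  let B : (n → K) →ₗ[K] (n → K) →ₗ[K] K := LinearMap.mk₂ K (fun x y => b (o x) (o y))
    (by simp [h1]) (by simp [h4']) (fun x y z => by simp only [map_add]; rw [h2, h1, h2, h2 (o z)])
    (fun c x y => by simp only [map_smul]; rw [h2, h4', h2, smul_eq_mul])
  let Z : Matrix n n K := LinearMap.toMatrix₂' K B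
  have hB : ∀ x y, B x y = x ⬝ᵥ Z *ᵥ y := fun x y => by
    rw [← Matrix.toLinearMap₂'_apply', Matrix.toLinearMap₂'_toMatrix']
  have hZ : ∀ i j, Z i j = b (o (Pi.single i 1)) (o (Pi.single j 1)) := fun i j =>
    LinearMap.toMatrix₂'_apply _ _ _
  have hZA : ∀ i j, (Z * A) i j = b (o (Pi.single i 1)) (o (A *ᵥ Pi.single j 1)) := fun i j => by
    change _ = B _ _
    rw [hB, mulVec_mulVec]
    simp
  refine ⟨Z, ?_, ?_, ?_⟩
  · ext i j
    rw [transpose_apply, hZ, hZ, h2]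
  · rw [isUnit_iff_ne_zero]
    intro h0
    obtain ⟨v, hv, hv0⟩ := exists_vecMul_eq_zero_iff.2 h0
    apply hv
    have := h5 (o v) fun y => by
      obtain ⟨y, rfl⟩ := o.surjective y
      change B v y = 0
      rw [hB, dotProduct_mulVec, hv0, zero_dotProduct]
    simpa using this
  · ext i j
    rw [transpose_apply, hZA, hZA, h2]
    have h : ∀ v, o (A *ᵥ v) = (X : K[X]) • o v := fun v => (Module.AEval'.X_smul_of φ v).symm
    rw [h, h, h3]

/-! ### Lagrangian frames and symmetric matrices with prescribed action -/

/-- For `A` a square matrix over a field, some coordinate subspace is a complement of the range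
of `A`. -/
theorem exists_coordinate_complement {K n : Type*} [Field K] [Fintype n] [DecidableEq n]
    (A : Matrix n n K) : ∃ I : Set n,
      (∀ v, (∀ i ∉ I, (A *ᵥ v) i = 0) → A *ᵥ v = 0) ∧
      ∀ u, (∀ i ∈ I, u i = 0) → u ᵥ* A = 0 → u = 0 := by
  classical
  let W : Submodule K (n → K) := LinearMap.range A.mulVecLin
  let w : n → (n → K) ⧸ W := fun i => W.mkQ (Pi.single i 1)
  -- I indexes basis vectors whose classes form a basis of Kⁿ / range A. Independence gives the
  -- first property, spanning the second.
  obtain ⟨I, -, -, hspan, hI⟩ := exists_linearIndepOn_extension (K := K) (v := w)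
    (linearIndepOn_empty K w) (Set.subset_univ ∅)
  refine ⟨I, fun v hv => ?_, fun u hu huA => ?_⟩
  · have hmem : W.mkQ (A *ᵥ v) = 0 := by
      rw [Submodule.mkQ_apply, Submodule.Quotient.mk_eq_zero]
      exact ⟨v, rfl⟩
    generalize A *ᵥ v = x at *
    have hx : ∑ i, x i • w i = 0 := by
      rw [← hmem]
      conv_rhs => rw [pi_eq_sum_univ' x]
      simp only [map_sum, w, ← map_smul]
    have hx' : ∑ i ∈ I.toFinset, x i • w i = 0 := by
      rw [← hx]
      refine Finset.sum_subset (Finset.subset_univ _) fun i _ hi => ?_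
      rw [hv i (by simpa using hi), zero_smul]
    funext i
    by_cases hi : i ∈ I
    · exact linearIndepOn_iff'.1 hI I.toFinset x (by simp) hx' i (by simpa using hi)
    · exact hv i hi
  · funext j
    have hj : w j ∈ Submodule.span K (w '' I) := hspan ⟨j, Set.mem_univ j, rfl⟩
    have hw : w '' I = W.mkQ '' ((fun i => (Pi.single i 1 : n → K)) '' I) := by
      rw [Set.image_image]
    rw [hw, Submodule.span_image] at hj
    obtain ⟨z, hz, hzj⟩ := hj
    have hz0 : u ⬝ᵥ z = 0 := by
      clear hzj
      induction hz using Submodule.span_induction with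
      | mem x hx =>
        obtain ⟨i, hi, rfl⟩ := hx
        simp [hu i hi]
      | zero => simp
      | add x y _ _ hx hy => rw [dotProduct_add, hx, hy, add_zero]
      | smul c x _ hx => rw [dotProduct_smul, hx, smul_zero]
    obtain ⟨t, ht⟩ := (Submodule.Quotient.eq W).1 hzj
    have h0 : u ⬝ᵥ (z - Pi.single j 1) = 0 := by
      rw [← ht, mulVecLin_apply, dotProduct_mulVec, huA, zero_dotProduct]
    rw [dotProduct_sub, hz0] at h0
    simpa using h0

/-- A Lagrangian frame can be sheared to have an invertible upper block. -/
theorem exists_isSymm_isUnit_det_add_mul {K n : Type*} [Field K] [Fintype n] [DecidableEq n]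
    {A C : Matrix n n K} (hAC : Aᵀ * C = Cᵀ * A)
    (hker : ∀ v, A *ᵥ v = 0 → C *ᵥ v = 0 → v = 0) :
    ∃ X : Matrix n n K, X.IsSymm ∧ IsUnit (A + X * C).det := by
  classical
  obtain ⟨I, h1, h2⟩ := exists_coordinate_complement A
  -- If (A + XC)v = 0, then Av vanishes off I, so Av = 0. Hence Cv vanishes on I, and AᵀCv = CᵀAv =
  -- 0 forces Cv = 0.
  let X : Matrix n n K := diagonal fun i => if i ∈ I then 1 else 0
  refine ⟨X, isSymm_diagonal _, ?_⟩
  rw [isUnit_iff_ne_zero]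
  intro h0
  obtain ⟨v, hv, hv0⟩ := exists_mulVec_eq_zero_iff.2 h0
  have hcoord : ∀ i, (A *ᵥ v) i + (if i ∈ I then 1 else 0) * (C *ᵥ v) i = 0 := fun i => by
    have := congrFun hv0 i
    rwa [add_mulVec, ← mulVec_mulVec, Pi.add_apply, mulVec_diagonal] at this
  have hA : A *ᵥ v = 0 := h1 v fun i hi => by simpa [hi] using hcoord i
  refine hv (hker v hA (h2 _ (fun i hi => by simpa [hi, hA] using hcoord i) ?_))
  rw [← mulVec_transpose, mulVec_mulVec, hAC, ← mulVec_mulVec, hA, mulVec_zero]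

/-- A nonzero vector can be mapped to any vector by a symmetric matrix. -/
theorem exists_isSymm_mulVec_eq {K n : Type*} [Field K] [Fintype n] [DecidableEq n]
    {p : n → K} (hp : p ≠ 0) (q : n → K) : ∃ S : Matrix n n K, S.IsSymm ∧ S *ᵥ p = q := by
  obtain ⟨i, hi⟩ := Function.ne_iff.1 hp
  let u : n → K := Pi.single i (p i)⁻¹
  have hu : u ⬝ᵥ p = 1 := by simpa [u] using inv_mul_cancel₀ hi
  -- Since u ⬝ᵥ p = 1, the first term sends p to q, and the last cancels the symmetrizing term on p.
  refine ⟨vecMulVec q u + vecMulVec u q - (q ⬝ᵥ p) • vecMulVec u u, ?_, ?_⟩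
  · ext a b
    simp only [transpose_apply, Matrix.sub_apply, Matrix.add_apply, Matrix.smul_apply,
      vecMulVec_apply, smul_eq_mul]
    ring
  · ext a
    simp [sub_mulVec, add_mulVec, vecMulVec_mulVec, smul_mulVec, hu]

/-! ### Symplectic shears and the five-factor decomposition -/

section

variable {K : Type*} [Field K] {d : ℕ}

theorem upper_mem {S : Matrix (Fin d) (Fin d) K} (hS : S.IsSymm) :
    upper S ∈ symplecticGroup (Fin d) K :=
  SymplecticGroup.fromBlocks_mem_iff.2 (by simp [hS.eq])

theorem lower_mem {S : Matrix (Fin d) (Fin d) K} (hS : S.IsSymm) :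
    lower S ∈ symplecticGroup (Fin d) K :=
  SymplecticGroup.fromBlocks_mem_iff.2 (by simp [hS.eq])

theorem inv_mem_symplecticGroup {A : Matrix (Fin d ⊕ Fin d) (Fin d ⊕ Fin d) K}
    (hA : A ∈ symplecticGroup (Fin d) K) : A⁻¹ ∈ symplecticGroup (Fin d) K := by
  have := (⟨A, hA⟩ : symplecticGroup (Fin d) K)⁻¹.2
  rwa [SymplecticGroup.coe_inv'] at this

theorem upper_mulVec (S : Matrix (Fin d) (Fin d) K) (p q : Fin d → K) :
    upper S *ᵥ Sum.elim p q = Sum.elim (p + S *ᵥ q) q := by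
  simp [upper, fromBlocks_mulVec]

theorem lower_mulVec (S : Matrix (Fin d) (Fin d) K) (p q : Fin d → K) :
    lower S *ᵥ Sum.elim p q = Sum.elim p (S *ᵥ p + q) := by
  simp [lower, fromBlocks_mulVec]

/-- Every nonzero vector is a column of a symplectic matrix. -/
theorem exists_symplectic_mulVec_single {v : Fin d ⊕ Fin d → K} (hv : v ≠ 0) (i : Fin d) :
    ∃ Q ∈ symplecticGroup (Fin d) K, Q *ᵥ Sum.elim (Pi.single i 1) 0 = v := by
  obtain ⟨p, q, rfl⟩ : ∃ p q, v = Sum.elim p q := ⟨v ∘ Sum.inl, v ∘ Sum.inr, by simp⟩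
  have he : (Pi.single i 1 : Fin d → K) ≠ 0 := by simp
  by_cases hq : q = 0
  · subst hq
    have hp : p ≠ 0 := by
      rintro rfl
      exact hv (by simp)
    -- Path (e, 0) → (e, e) → (p, e) → (p, 0); the last shear needs p ≠ 0.
    obtain ⟨S, hS, hSe⟩ := exists_isSymm_mulVec_eq he (Pi.single i 1)
    obtain ⟨T, hT, hTe⟩ := exists_isSymm_mulVec_eq he (p - Pi.single i 1)
    obtain ⟨U, hU, hUe⟩ := exists_isSymm_mulVec_eq hp (-Pi.single i 1)
    refine ⟨lower U * (upper T * lower S),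
      mul_mem (lower_mem hU) (mul_mem (upper_mem hT) (lower_mem hS)), ?_⟩
    rw [← mulVec_mulVec, ← mulVec_mulVec, lower_mulVec, upper_mulVec, lower_mulVec, hSe,
      add_zero, hTe, add_sub_cancel, hUe, neg_add_cancel]
  · obtain ⟨S, hS, hSe⟩ := exists_isSymm_mulVec_eq he q
    obtain ⟨T, hT, hTe⟩ := exists_isSymm_mulVec_eq hq (p - Pi.single i 1)
    refine ⟨upper T * lower S, mul_mem (upper_mem hT) (lower_mem hS), ?_⟩
    rw [← mulVec_mulVec, lower_mulVec, upper_mulVec, hSe, add_zero, hTe, add_sub_cancel]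

/-- Two symplectic matrices with equal left halves differ by an upper unit triangular one. -/
theorem exists_eq_mul_upper {A B C D B' D' : Matrix (Fin d) (Fin d) K}
    (hH : fromBlocks A B C D ∈ symplecticGroup (Fin d) K)
    (hG : fromBlocks A B' C D' ∈ symplecticGroup (Fin d) K) :
    ∃ S : Matrix (Fin d) (Fin d) K, S.IsSymm ∧
      fromBlocks A B C D = fromBlocks A B' C D' * upper S := by
  have hdet := SymplecticGroup.symplectic_det hG
  have hN : (fromBlocks A B' C D')⁻¹ * fromBlocks A B C D ∈ symplecticGroup (Fin d) K :=
    mul_mem (inv_mem_symplecticGroup hG) hH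
  have hGN : fromBlocks A B C D =
      fromBlocks A B' C D' * ((fromBlocks A B' C D')⁻¹ * fromBlocks A B C D) :=
    (mul_nonsing_inv_cancel_left _ _ hdet).symm
  -- The quotient N has left half [1; 0]; being symplectic then forces its right half to be [b; 1]
  -- with b symmetric.
  have hE : (fromBlocks A B' C D')⁻¹ * fromBlocks A B C D *
      (fromBlocks 1 0 0 0 : Matrix (Fin d ⊕ Fin d) (Fin d ⊕ Fin d) K) = fromBlocks 1 0 0 0 := by
    rw [mul_assoc, show fromBlocks A B C D *
      (fromBlocks 1 0 0 0 : Matrix (Fin d ⊕ Fin d) (Fin d ⊕ Fin d) K) =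
      fromBlocks A B' C D' * fromBlocks 1 0 0 0 by simp [fromBlocks_multiply],
      nonsing_inv_mul_cancel_left _ _ hdet]
  generalize (fromBlocks A B' C D')⁻¹ * fromBlocks A B C D = N at *
  obtain ⟨a, b, c, e, rfl⟩ : ∃ a b c e, N = fromBlocks a b c e :=
    ⟨_, _, _, _, (fromBlocks_toBlocks N).symm⟩
  simp only [fromBlocks_multiply, mul_one, mul_zero, add_zero, fromBlocks_inj] at hE
  obtain ⟨rfl, -, rfl, -⟩ := hE
  obtain ⟨-, h2, h3⟩ := SymplecticGroup.fromBlocks_mem_iff.1 hN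
  have he : e = 1 := by simpa using h3
  subst he
  exact ⟨b, by simpa [IsSymm] using h2, hGN⟩

/-- The equations `hC` and `hA` match left halves only; `exists_eq_mul_upper` supplies the last
factor. -/
theorem exists_eq_upper_lower_upper_lower_upper {A B C D X P₄ S₃ P₂ : Matrix (Fin d) (Fin d) K}
    (hH : fromBlocks A B C D ∈ symplecticGroup (Fin d) K) (hX : X.IsSymm) (h4 : P₄.IsSymm)
    (h3 : S₃.IsSymm) (h2 : P₂.IsSymm) (hC : C = P₄ * (A + X * C) + P₂)
    (hA : A + X * C - 1 = S₃ * P₂) :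
    ∃ S₁ : Matrix (Fin d) (Fin d) K, S₁.IsSymm ∧
      fromBlocks A B C D = upper (-X) * lower P₄ * upper S₃ * lower P₂ * upper S₁ := by
  have hG : upper (-X) * lower P₄ * upper S₃ * lower P₂ ∈ symplecticGroup (Fin d) K :=
    mul_mem (mul_mem (mul_mem (upper_mem hX.neg) (lower_mem h4)) (upper_mem h3)) (lower_mem h2)
  obtain ⟨B', D', h⟩ : ∃ B' D', upper (-X) * lower P₄ * upper S₃ * lower P₂ =
      fromBlocks A B' C D' := by
    rw [mul_assoc, mul_assoc]
    have e1 : upper S₃ * lower P₂ = fromBlocks (A + X * C) S₃ P₂ 1 := by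
      simp [upper, lower, fromBlocks_multiply, ← hA]
    have e2 : lower P₄ * fromBlocks (A + X * C) S₃ P₂ 1 =
        fromBlocks (A + X * C) S₃ C (P₄ * S₃ + 1) := by
      simp [lower, fromBlocks_multiply, ← hC]
    rw [e1, e2]
    exact ⟨S₃ + -X * (P₄ * S₃ + 1), P₄ * S₃ + 1, by simp [upper, fromBlocks_multiply]⟩
  rw [h] at hG ⊢
  exact exists_eq_mul_upper hH hG

/-- The shear making the upper left block of a symplectic matrix invertible. -/
theorem exists_isSymm_shear {A B C D : Matrix (Fin d) (Fin d) K}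
    (hH : fromBlocks A B C D ∈ symplecticGroup (Fin d) K) :
    ∃ X : Matrix (Fin d) (Fin d) K, X.IsSymm ∧ IsUnit (A + X * C).det ∧
      (C * (A + X * C)⁻¹).IsSymm := by
  have hAC := (SymplecticGroup.fromBlocks_mem_iff.1 hH).1
  obtain ⟨X, hX, hdet⟩ := exists_isSymm_isUnit_det_add_mul hAC fun v hA hC => by
    have h0 : fromBlocks A B C D *ᵥ Sum.elim v 0 = fromBlocks A B C D *ᵥ 0 := by
      simp [fromBlocks_mulVec, hA, hC]
    have h1 := (mulVec_injective_iff_isUnit.2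
      ((isUnit_iff_isUnit_det _).2 (SymplecticGroup.symplectic_det hH))) h0
    funext i
    simpa using congrFun h1 (Sum.inl i)
  refine ⟨X, hX, hdet, ?_⟩
  have hcomm : (A + X * C)ᵀ * C = Cᵀ * (A + X * C) := by
    rw [transpose_add, transpose_mul, hX.eq, add_mul, mul_add, hAC, mul_assoc]
  generalize A + X * C = G at *
  have hdet' : IsUnit (Gᵀ).det := by rwa [det_transpose]
  rw [IsSymm, transpose_mul, transpose_nonsing_inv]
  calc Gᵀ⁻¹ * Cᵀ = Gᵀ⁻¹ * (Cᵀ * G) * G⁻¹ := by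
        rw [mul_assoc, mul_assoc, mul_nonsing_inv _ hdet, mul_one]
    _ = C * G⁻¹ := by rw [← hcomm, nonsing_inv_mul_cancel_left _ _ hdet']

theorem mem_unitTriangularProducts_five {Q : Matrix (Fin d ⊕ Fin d) (Fin d ⊕ Fin d) K}
    (hQ : Q ∈ symplecticGroup (Fin d) K) : Q ∈ unitTriangularProducts d K 5 := by
  obtain ⟨A, B, C, D, rfl⟩ : ∃ A B C D, Q = fromBlocks A B C D :=
    ⟨_, _, _, _, (fromBlocks_toBlocks Q).symm⟩
  obtain ⟨X, hX, hdet, hY⟩ := exists_isSymm_shear hQ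
  obtain ⟨Z, hZ, hZdet, hP⟩ := exists_isSymm_mul_isSymm (A + X * C)
  have hPdet : IsUnit (Z * (A + X * C)).det := by
    rw [det_mul]
    exact hZdet.mul hdet
  obtain ⟨S₁, h1, h⟩ := exists_eq_upper_lower_upper_lower_upper hQ hX (hY.sub hZ)
    (hZ.inv.sub hP.inv) hP
    (by rw [sub_mul, nonsing_inv_mul_cancel_right _ _ hdet, sub_add_cancel])
    (by rw [sub_mul, nonsing_inv_mul _ hPdet, nonsing_inv_mul_cancel_left _ _ hZdet])
  refine ⟨[_, _, _, _, _], rfl, ?_, by simpa [mul_assoc] using h⟩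
  simp only [List.mem_cons, List.not_mem_nil, or_false, forall_eq_or_imp, forall_eq]
  exact ⟨⟨_, hX.neg, .inl rfl⟩, ⟨_, hY.sub hZ, .inr rfl⟩, ⟨_, hZ.inv.sub hP.inv, .inl rfl⟩,
    ⟨_, hP, .inr rfl⟩, ⟨_, h1, .inl rfl⟩⟩

end

/-! ### Padded blocks and symplectic matrices fixing a basis vector -/

section

variable {K : Type*} [Field K] {n : ℕ}

theorem lower_padZero_zero {d : ℕ} :
    lower (padZero (0 : Matrix (Fin (d - 1)) (Fin (d - 1)) K)) = 1 := by
  rw [show padZero (0 : Matrix (Fin (d - 1)) (Fin (d - 1)) K) = 0 by ext; simp [padZero], lower,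
    fromBlocks_one]

theorem padZero_zero_left (S : Matrix (Fin n) (Fin n) K) (j : Fin (n + 1)) :
    padZero (d := n + 1) S 0 j = 0 := by
  simp [padZero]

theorem padZero_zero_right (S : Matrix (Fin n) (Fin n) K) (i : Fin (n + 1)) :
    padZero (d := n + 1) S i 0 = 0 := by
  simp [padZero]

theorem padZero_succ_succ (S : Matrix (Fin n) (Fin n) K) (i j : Fin n) :
    padZero (d := n + 1) S i.succ j.succ = S i j := by
  simp [padZero]

theorem padZero_isSymm {S : Matrix (Fin n) (Fin n) K} (hS : S.IsSymm) :
    (padZero (d := n + 1) S).IsSymm := by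
  refine IsSymm.ext fun i j => ?_
  cases i using Fin.cases <;> cases j using Fin.cases <;>
    simp only [padZero_zero_left, padZero_zero_right, padZero_succ_succ]
  exact hS.apply _ _

theorem padZero_mulVec_single_zero (S : Matrix (Fin n) (Fin n) K) :
    padZero (d := n + 1) S *ᵥ Pi.single 0 1 = 0 := by
  ext i
  simp [padZero_zero_right]

theorem eq_padZero {S : Matrix (Fin (n + 1)) (Fin (n + 1)) K} (hS : S.IsSymm)
    (h0 : S *ᵥ Pi.single 0 1 = 0) : S = padZero (d := n + 1) (S.submatrix Fin.succ Fin.succ) := by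
  have h : ∀ i, S i 0 = 0 := fun i => by simpa using congrFun h0 i
  ext i j
  cases i using Fin.cases <;> cases j using Fin.cases <;>
    simp only [padZero_zero_left, padZero_zero_right, padZero_succ_succ, h, submatrix_apply]
  rw [hS.apply, h]

theorem padZero_sub (S T : Matrix (Fin n) (Fin n) K) :
    padZero (d := n + 1) (S - T) = padZero (d := n + 1) S - padZero (d := n + 1) T := by
  ext i j
  cases i using Fin.cases <;> cases j using Fin.cases <;>
    simp [padZero_zero_left, padZero_zero_right, padZero_succ_succ]

theorem padZero_mul (S : Matrix (Fin n) (Fin n) K) {A : Matrix (Fin (n + 1)) (Fin (n + 1)) K}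
    (hA : A *ᵥ Pi.single 0 1 = Pi.single 0 1) :
    padZero (d := n + 1) S * A = padZero (d := n + 1) (S * A.submatrix Fin.succ Fin.succ) := by
  have h : ∀ i : Fin n, A i.succ 0 = 0 := fun i => by simpa using congrFun hA i.succ
  ext i j
  cases i using Fin.cases <;> cases j using Fin.cases <;>
    simp [padZero_zero_left, padZero_zero_right, padZero_succ_succ, mul_apply, Fin.sum_univ_succ, h]

theorem det_submatrix_succ {A : Matrix (Fin (n + 1)) (Fin (n + 1)) K}
    (hA : A *ᵥ Pi.single 0 1 = Pi.single 0 1) :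
    (A.submatrix Fin.succ Fin.succ).det = A.det := by
  have h : ∀ i : Fin n, A i.succ 0 = 0 := fun i => by simpa using congrFun hA i.succ
  have h0 : A 0 0 = 1 := by simpa using congrFun hA 0
  rw [det_succ_column_zero, Fin.sum_univ_succ]
  simp [h, h0]

/-- The symmetrization of a matrix fixing the first basis vector, supported on the complement of
that vector. -/
theorem exists_padZero_isSymm {A : Matrix (Fin (n + 1)) (Fin (n + 1)) K}
    (hA : A *ᵥ Pi.single 0 1 = Pi.single 0 1) (hdet : IsUnit A.det) :
    ∃ (Z P : Matrix (Fin n) (Fin n) K) (S : Matrix (Fin (n + 1)) (Fin (n + 1)) K),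
      Z.IsSymm ∧ P.IsSymm ∧ S.IsSymm ∧ padZero (d := n + 1) Z * A = padZero (d := n + 1) P ∧
        A - 1 = S * padZero (d := n + 1) P := by
  obtain ⟨Z, hZ, hZdet, hP⟩ := exists_isSymm_mul_isSymm (A.submatrix Fin.succ Fin.succ)
  have h : ∀ i : Fin n, A i.succ 0 = 0 := fun i => by simpa using congrFun hA i.succ
  have h0 : A 0 0 = 1 := by simpa using congrFun hA 0
  have hmul := padZero_mul Z hA
  have hPdet : IsUnit (Z * A.submatrix Fin.succ Fin.succ).det := by
    rw [det_mul, det_submatrix_succ hA]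
    exact hZdet.mul hdet
  have hT : (Z⁻¹ - (Z * A.submatrix Fin.succ Fin.succ)⁻¹) * (Z * A.submatrix Fin.succ Fin.succ) =
      A.submatrix Fin.succ Fin.succ - 1 := by
    rw [sub_mul, nonsing_inv_mul _ hPdet, nonsing_inv_mul_cancel_left _ _ hZdet]
  have hTs : (Z⁻¹ - (Z * A.submatrix Fin.succ Fin.succ)⁻¹).IsSymm := hZ.inv.sub hP.inv
  generalize Z⁻¹ - (Z * A.submatrix Fin.succ Fin.succ)⁻¹ = T at *
  generalize Z * A.submatrix Fin.succ Fin.succ = P at *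
  -- With A = [1 a; 0 A'], the equation A - 1 = S diag(0, P) needs bP = a and TP = A' - 1 for S = [0
  -- b; bᵀ T].
  let b : Fin n → K := (fun j => A 0 j.succ) ᵥ* P⁻¹
  have hb : b ᵥ* P = fun j => A 0 j.succ := by
    rw [vecMul_vecMul, nonsing_inv_mul _ hPdet, vecMul_one]
  let S : Matrix (Fin (n + 1)) (Fin (n + 1)) K :=
    Matrix.of (Fin.cons (Fin.cons 0 b) fun i => Fin.cons (b i) (T i))
  refine ⟨Z, P, S, hZ, hP, IsSymm.ext fun i j => ?_, hmul, ?_⟩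
  · cases i using Fin.cases <;> cases j using Fin.cases <;> simp [S]
    exact hTs.apply _ _
  · ext i j
    cases i using Fin.cases with
    | zero =>
      cases j using Fin.cases with
      | zero => simp [mul_apply, padZero_zero_right, h0]
      | succ j =>
        have := congrFun hb j
        simp only [vecMul, dotProduct] at this
        simp [S, mul_apply, Fin.sum_univ_succ, padZero_zero_left, padZero_succ_succ, this,
          (Fin.succ_ne_zero j).symm]
    | succ i =>
      cases j using Fin.cases with
      | zero => simp [mul_apply, padZero_zero_right, h]
      | succ j =>
        have := congrFun (congrFun hT i) j
        rw [mul_apply] at this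
        simp [S, mul_apply, Fin.sum_univ_succ, padZero_zero_left, padZero_succ_succ, this,
          one_apply]

/-- A symplectic matrix fixing the first basis vector is a product of five unit triangular
symplectic matrices fixing this vector. -/
theorem exists_eq_of_mulVec_single
    {H : Matrix (Fin (n + 1) ⊕ Fin (n + 1)) (Fin (n + 1) ⊕ Fin (n + 1)) K}
    (hH : H ∈ symplecticGroup (Fin (n + 1)) K)
    (hfix : H *ᵥ Sum.elim (Pi.single 0 1) 0 = Sum.elim (Pi.single 0 1) 0) :
    ∃ (S₁ S₃ S₅ : Matrix (Fin (n + 1)) (Fin (n + 1)) K) (S₂ S₄ : Matrix (Fin n) (Fin n) K),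
      S₁.IsSymm ∧ S₃.IsSymm ∧ S₅.IsSymm ∧ S₂.IsSymm ∧ S₄.IsSymm ∧
        H = upper S₅ * lower (padZero S₄) * upper S₃ * lower (padZero S₂) * upper S₁ := by
  obtain ⟨A, B, C, D, rfl⟩ : ∃ A B C D, H = fromBlocks A B C D :=
    ⟨_, _, _, _, (fromBlocks_toBlocks H).symm⟩
  rw [fromBlocks_mulVec, Sum.elim_eq_iff] at hfix
  obtain ⟨hA, hC⟩ := hfix
  simp only [Sum.elim_comp_inl, Sum.elim_comp_inr, mulVec_zero, add_zero] at hA hC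
  obtain ⟨X, hX, hdet, hY⟩ := exists_isSymm_shear hH
  have hA1 : (A + X * C) *ᵥ Pi.single 0 1 = Pi.single 0 1 := by
    rw [add_mulVec, hA, ← mulVec_mulVec, hC, mulVec_zero, add_zero]
  obtain ⟨Z, P, S, hZ, hP, hS, hZP, hAS⟩ := exists_padZero_isSymm hA1 hdet
  -- As G = A + XC fixes e and C kills it, C G⁻¹ kills e; being symmetric, it is padded.
  have hY0 : (C * (A + X * C)⁻¹) *ᵥ Pi.single 0 1 = 0 := by
    conv_lhs => rw [← hA1]
    rw [mulVec_mulVec, nonsing_inv_mul_cancel_right _ _ hdet, hC]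
  have hYpad := eq_padZero hY hY0
  have hY' := hY.submatrix (Fin.succ : Fin n → Fin (n + 1))
  obtain ⟨S₁, h1, h⟩ := exists_eq_upper_lower_upper_lower_upper hH hX
    (padZero_isSymm (hY'.sub hZ)) hS (padZero_isSymm hP)
    (by rw [padZero_sub, ← hYpad, sub_mul, nonsing_inv_mul_cancel_right _ _ hdet, hZP,
      sub_add_cancel]) hAS
  exact ⟨S₁, S, -X, P, _, h1, hS, hX.neg, hP, hY'.sub hZ, h⟩

end

end UnitTriangularSymplectic

/-! ### The main theorem -/

theorem mainTheorem7 (K : Type*) [RCLike K] (d : ℕ) (hd : 1 ≤ d) :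
    UnitTriangularSymplectic.singularSymplectic d K =
      {H | ∃ (S₁ S₃ S₅ : Matrix (Fin d) (Fin d) K)
          (S₂ S₄ S₆ : Matrix (Fin (d - 1)) (Fin (d - 1)) K)
          (Q : Matrix (Fin d ⊕ Fin d) (Fin d ⊕ Fin d) K),
          S₁.IsSymm ∧ S₃.IsSymm ∧ S₅.IsSymm ∧ S₂.IsSymm ∧ S₄.IsSymm ∧ S₆.IsSymm ∧
          Q ∈ Matrix.symplecticGroup (Fin d) K ∧
          H = Q *
            (UnitTriangularSymplectic.lower (UnitTriangularSymplectic.padZero S₆) *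
              UnitTriangularSymplectic.upper S₅ *
              UnitTriangularSymplectic.lower (UnitTriangularSymplectic.padZero S₄) *
              UnitTriangularSymplectic.upper S₃ *
              UnitTriangularSymplectic.lower (UnitTriangularSymplectic.padZero S₂) *
              UnitTriangularSymplectic.upper S₁) * Q⁻¹} ∧
    ∀ Q ∈ Matrix.symplecticGroup (Fin d) K,
      Q ∈ UnitTriangularSymplectic.unitTriangularProducts d K 5 := by
  refine ⟨?_, fun Q hQ => UnitTriangularSymplectic.mem_unitTriangularProducts_five hQ⟩
  obtain ⟨n, rfl⟩ : ∃ n, d = n + 1 := ⟨d - 1, by omega⟩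
  open UnitTriangularSymplectic in
  ext H
  constructor
  · rintro ⟨hH, hdet⟩
    obtain ⟨v, hv, hHv⟩ := exists_mulVec_eq_zero_iff.2 hdet
    rw [sub_mulVec, one_mulVec, sub_eq_zero] at hHv
    obtain ⟨Q, hQ, hQv⟩ := exists_symplectic_mulVec_single hv (0 : Fin (n + 1))
    have hQdet := SymplecticGroup.symplectic_det hQ
    obtain ⟨S₁, S₃, S₅, S₂, S₄, h1, h3, h5, h2, h4, h⟩ := exists_eq_of_mulVec_single
      (H := Q⁻¹ * H * Q) (mul_mem (mul_mem (inv_mem_symplecticGroup hQ) hH) hQ) (by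
        rw [← mulVec_mulVec, hQv, ← mulVec_mulVec, hHv, ← hQv, mulVec_mulVec,
          nonsing_inv_mul _ hQdet, one_mulVec])
    refine ⟨S₁, S₃, S₅, S₂, S₄, 0, Q, h1, h3, h5, h2, h4, isSymm_zero, hQ, ?_⟩
    rw [lower_padZero_zero, one_mul, ← h, mul_assoc, mul_assoc, mul_assoc, mul_nonsing_inv _ hQdet,
      mul_one, mul_nonsing_inv_cancel_left _ _ hQdet]
  · rintro ⟨S₁, S₃, S₅, S₂, S₄, S₆, Q, h1, h3, h5, h2, h4, h6, hQ, rfl⟩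
    have hQdet := SymplecticGroup.symplectic_det hQ
    have hl : ∀ S : Matrix (Fin (n + 1 - 1)) (Fin (n + 1 - 1)) K, lower (padZero S) *ᵥ
        Sum.elim (Pi.single 0 1) 0 = Sum.elim (Pi.single 0 1) 0 := fun S => by
      rw [lower_mulVec, show padZero S *ᵥ Pi.single 0 1 = 0 from padZero_mulVec_single_zero S,
        add_zero]
    have hu : ∀ S : Matrix (Fin (n + 1)) (Fin (n + 1)) K, upper S *ᵥ
        Sum.elim (Pi.single 0 1) 0 = Sum.elim (Pi.single 0 1) 0 := fun S => by
      rw [upper_mulVec, mulVec_zero, add_zero]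
    refine ⟨mul_mem (mul_mem hQ ?_) (inv_mem_symplecticGroup hQ), ?_⟩
    · exact mul_mem (mul_mem (mul_mem (mul_mem (mul_mem (lower_mem (padZero_isSymm h6))
        (upper_mem h5)) (lower_mem (padZero_isSymm h4))) (upper_mem h3))
        (lower_mem (padZero_isSymm h2))) (upper_mem h1)
    -- The conjugated product fixes Qe, which is nonzero because Q is invertible.
    · refine exists_mulVec_eq_zero_iff.1 ⟨Q *ᵥ Sum.elim (Pi.single 0 1) 0, fun h0 => ?_, ?_⟩
      · have := congrArg (Q⁻¹ *ᵥ ·) h0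
        simp only [mulVec_mulVec, nonsing_inv_mul _ hQdet, one_mulVec, mulVec_zero] at this
        simpa using congrFun this (Sum.inl 0)
      · rw [sub_mulVec, one_mulVec, sub_eq_zero, mulVec_mulVec,
          nonsing_inv_mul_cancel_right _ _ hQdet]
        simp only [← mulVec_mulVec, hu, hl]
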